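/- Let $1\le p<n$ and let $A\in\mathbb{R}^{n\times n}$ be symmetric with eigenvalues $\lambda_1\ge\cdots\ge\lambda_n$ (counted with multiplicity). Put $\delta=\lambda_p-\lambda_{p+1}$, $L=\lambda_1-\lambda_n$, $c_Q=2/\pi^2$, and assume $\delta>0$. Let $V_\alpha\in\mathbb{R}^{n\times p}$ have orthonormal columns spanning the dominant subspace of $A$, i.e. the invariant subspace belonging to $\lambda_1,\dots,\lambda_p$. For $X\in\mathbb{R}^{n\times p}$ with $X^TX=I$ let $$\phi(X)=-\tfrac12\operatorname{Tr}(X^TAX),\qquad \operatorname{grad}\phi(X)=-(AX-XX^TAX),$$ let $\phi^*$ be the minimum of $\phi$ over all such $X$, and let $\operatorname{dist}(X,V_\alpha)=(\theta_1^2+\cdots+\theta_p^2)^{1/2}$, where $0\le\theta_1\le\cdots\le\theta_p\le\pi/2$ are the principal angles between the column spans of $X$ and $V_\alpha$ (the arc cosines of the singular values of $V_\alpha^TX$). Consider Riemannian gradient descent on the Grassmannian with exact line search and polar retraction: given $X_k$ with $X_k^TX_k=I$, put $G=\operatorname{grad}\phi(X_k)$; diagonalize $G^TG=V\operatorname{Diag}(\beta_1,\dots,\beta_p)V^T$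 with $V$ orthogonal; put $\alpha_i=((X_kV)^TA(X_kV))_{ii}$ and $\gamma_i=((GV)^TA(GV))_{ii}$; let $\mu\ge 0$ be a minimizer over $[0,\infty)$ of $$\mu\mapsto-\frac12\sum_{i=1}^p\frac{\alpha_i+2\beta_i\mu+\gamma_i\mu^2}{1+\beta_i\mu^2};$$ and let $$X_{k+1}=(X_k-\mu G)\,V\operatorname{Diag}\big((1+\mu^2\beta_1)^{-1/2},\dots,(1+\mu^2\beta_p)^{-1/2}\big)V^T.$$ If $X_0^TX_0=I$ and $$\operatorname{dist}(X_0,V_\alpha)\le\sqrt{\frac{2c_Q\delta}{L}},$$ then all iterates $X_k$ produced by this algorithm (for any choice of the diagonalizations and minimizers, and whether it is run forever or stopped after finitely many steps) satisfy $$\phi(X_k)-\phi^*\le\Big(1-c_Q\frac{2\delta}{5L}\Big)^k\big(\phi(X_0)-\phi^*\big).$$ -/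

import Mathlib

noncomputable section

namespace GrassmannGD

open Matrix

/-- The Stiefel manifold: real `n × p` matrices with orthonormal columns. A point of the
Grassmannian is represented by any such matrix spanning it. -/
def stiefel (n p : ℕ) : Set (Matrix (Fin n) (Fin p) ℝ) := {X | Xᵀ * X = 1}

/-- The objective `φ(X) = -½ Tr(Xᵀ A X)`. -/
def phi {n p : ℕ} (A : Matrix (Fin n) (Fin n) ℝ) (X : Matrix (Fin n) (Fin p) ℝ) : ℝ :=
  -(1 / 2) * (Xᵀ * A * X).trace

/-- The minimal value `φ*` of `φ` over matrices with `p` orthonormal columns. -/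
def phiStar {n : ℕ} (A : Matrix (Fin n) (Fin n) ℝ) (p : ℕ) : ℝ :=
  sInf (phi A '' stiefel n p)

/-- The Riemannian gradient of `φ` on the Grassmannian at an orthonormal representative `X`. -/
def gradPhi {n p : ℕ} (A : Matrix (Fin n) (Fin n) ℝ) (X : Matrix (Fin n) (Fin p) ℝ) :
    Matrix (Fin n) (Fin p) ℝ :=
  -(A * X - X * (Xᵀ * A * X))

/-- The eigenvalues of the real symmetric matrix `A`, counted with multiplicity, in decreasing
order (zero-indexed: `eig hA 0` is the largest one). -/
def eig {n : ℕ} {A : Matrix (Fin n) (Fin n) ℝ} (hA : A.IsHermitian) (i : Fin n) : ℝ :=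
  (Matrix.isSymmetric_toEuclideanLin_iff.2 hA).eigenvalues finrank_euclideanSpace_fin i

theorem eig_antitone {n : ℕ} {A : Matrix (Fin n) (Fin n) ℝ} (hA : A.IsHermitian) :
    Antitone (eig hA) :=
  LinearMap.IsSymmetric.eigenvalues_antitone _ _

/-- The columns of `V` form an orthonormal basis of the invariant subspace of `A` that belongs to
its `p` largest eigenvalues. -/
def IsDominantBasis {n p : ℕ} {A : Matrix (Fin n) (Fin n) ℝ} (hA : A.IsHermitian) (hpn : p < n)
    (V : Matrix (Fin n) (Fin p) ℝ) : Prop :=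
  V ∈ stiefel n p ∧
    LinearMap.range (Matrix.toLin' V) =
      ⨆ i : Fin p, Module.End.eigenspace (Matrix.toLin' A) (eig hA (Fin.castLE hpn.le i))

/-- The principal angles `θ₁ ≤ ⋯ ≤ θ_p` between the column spans of orthonormal `X` and `Y`:
the arc cosines of the singular values of `Yᵀ X`. -/
def principalAngle {n p : ℕ} (X Y : Matrix (Fin n) (Fin p) ℝ) (i : Fin p) : ℝ :=
  Real.arccos ((Matrix.toEuclideanLin (Yᵀ * X)).singularValues i)

/-- The Riemannian distance on the Grassmannian, `(θ₁² + ⋯ + θ_p²)^{1/2}`. -/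
def grassmannDist {n p : ℕ} (X Y : Matrix (Fin n) (Fin p) ℝ) : ℝ :=
  √(∑ i, principalAngle X Y i ^ 2)

/-- The rational line-search function `μ ↦ -½ ∑ (αᵢ + 2 βᵢ μ + γᵢ μ²) / (1 + βᵢ μ²)`. -/
def lineSearchFun {p : ℕ} (α β γ : Fin p → ℝ) (μ : ℝ) : ℝ :=
  -(1 / 2) * ∑ i, (α i + 2 * β i * μ + γ i * μ ^ 2) / (1 + β i * μ ^ 2)

/-- `X'` is a possible result of one iteration, started at `X`, of Riemannian gradient descent
with exact line search and polar retraction. The diagonalization `Gᵀ G = V D_β Vᵀ` and the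
minimizing step `μ` need not be unique, hence a relation. -/
def GDStep {n p : ℕ} (A : Matrix (Fin n) (Fin n) ℝ) (X X' : Matrix (Fin n) (Fin p) ℝ) : Prop :=
  ∃ (V : Matrix (Fin p) (Fin p) ℝ) (β : Fin p → ℝ) (μ : ℝ),
    let G := gradPhi A X
    let α : Fin p → ℝ := fun i => ((X * V)ᵀ * A * (X * V)) i i
    let γ : Fin p → ℝ := fun i => ((G * V)ᵀ * A * (G * V)) i i
    V ∈ Matrix.orthogonalGroup (Fin p) ℝ ∧
    Gᵀ * G = V * Matrix.diagonal β * Vᵀ ∧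
    0 ≤ μ ∧ IsMinOn (lineSearchFun α β γ) (Set.Ici 0) μ ∧
    X' = (X - μ • G) * V * Matrix.diagonal (fun i => (√(1 + μ ^ 2 * β i))⁻¹) * Vᵀ

/-- The constant `c_Q = 2 / π²`. -/
def cQ : ℝ := 2 / Real.pi ^ 2

end GrassmannGD

end

namespace GrassmannGD

open Matrix

/-! ### Trace inner product and columnwise quadratic forms. -/

section Frobenius

variable {m n p : ℕ}

/-! Write `e = φ(X) - φ*`, `s = sinSq X V` and `g = ‖grad φ(X)‖²` (Frobenius norm). Three estimates
carry the proof. Quadratic growth: `δ s ≤ 2 e ≤ L s` (`gap_mul_sinSq_le`, `phi_sub_phi_le`), which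
also gives `φ* = φ(V)`. Gradient dominance: `δ e ≤ g` as long as `s ≤ 1/2` (`gradient_dominance`).
Sufficient decrease: an exact line search does at least as well as the step `1/L`, which lowers `φ`
by `2 g / (5 L)` (`GDStep.mem_stiefel_and_phi_le`).

The last two give `e' ≤ (1 - 2δ/(5L)) e`, stronger than the claimed rate since `c_Q ≤ 1`. The region
`s ≤ 1/2` is never left: `sin θ ≤ θ` turns the distance hypothesis into `e ≤ c_Q δ` at the start,
this bound persists because `e` decreases, and it forces `s ≤ 2 c_Q ≤ 1/2`. -/

theorem trace_transpose_mul_eq_sum (M N : Matrix (Fin m) (Fin p) ℝ) :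
    (Mᵀ * N).trace = ∑ j, M.col j ⬝ᵥ N.col j := by
  simp [Matrix.trace, Matrix.mul_apply, dotProduct, Matrix.col_apply]

theorem col_mul (M : Matrix (Fin m) (Fin n) ℝ) (N : Matrix (Fin n) (Fin p) ℝ) (j : Fin p) :
    (M * N).col j = M *ᵥ N.col j := by
  ext i
  simp [Matrix.mul_apply, Matrix.mulVec, dotProduct]

theorem dotProduct_self_nonneg' (x : Fin m → ℝ) : 0 ≤ x ⬝ᵥ x :=
  Finset.sum_nonneg fun i _ => mul_self_nonneg (x i)

theorem trace_gram_nonneg (M : Matrix (Fin m) (Fin p) ℝ) : 0 ≤ (Mᵀ * M).trace := by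
  rw [trace_transpose_mul_eq_sum]
  exact Finset.sum_nonneg fun j _ => dotProduct_self_nonneg' _

theorem le_trace_conj_of_le {A : Matrix (Fin m) (Fin m) ℝ} {M : Matrix (Fin m) (Fin p) ℝ} {c : ℝ}
    (h : ∀ j, c * (M.col j ⬝ᵥ M.col j) ≤ M.col j ⬝ᵥ A *ᵥ M.col j) :
    c * (Mᵀ * M).trace ≤ (Mᵀ * A * M).trace := by
  rw [Matrix.mul_assoc, trace_transpose_mul_eq_sum, trace_transpose_mul_eq_sum, Finset.mul_sum]
  exact Finset.sum_le_sum fun j _ => by rw [col_mul]; exact h j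

theorem trace_conj_le_of_le {A : Matrix (Fin m) (Fin m) ℝ} {M : Matrix (Fin m) (Fin p) ℝ} {c : ℝ}
    (h : ∀ j, M.col j ⬝ᵥ A *ᵥ M.col j ≤ c * (M.col j ⬝ᵥ M.col j)) :
    (Mᵀ * A * M).trace ≤ c * (Mᵀ * M).trace := by
  rw [Matrix.mul_assoc, trace_transpose_mul_eq_sum, trace_transpose_mul_eq_sum, Finset.mul_sum]
  exact Finset.sum_le_sum fun j _ => by rw [col_mul]; exact h j

theorem trace_transpose_mul_sq_le (M N : Matrix (Fin m) (Fin p) ℝ) :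
    (Mᵀ * N).trace ^ 2 ≤ (Mᵀ * M).trace * (Nᵀ * N).trace := by
  have h (M N : Matrix (Fin m) (Fin p) ℝ) :
      (Mᵀ * N).trace = ∑ x : Fin p × Fin m, M x.2 x.1 * N x.2 x.1 := by
    simp [Matrix.trace, Matrix.mul_apply, Fintype.sum_prod_type]
  simp only [h, ← pow_two]
  exact Finset.sum_mul_sq_le_sq_mul_sq _ _ _

theorem mulVec_dotProduct_mulVec (M : Matrix (Fin m) (Fin n) ℝ) (N : Matrix (Fin m) (Fin p) ℝ)
    (x : Fin n → ℝ) (y : Fin p → ℝ) : (M *ᵥ x) ⬝ᵥ (N *ᵥ y) = x ⬝ᵥ (Mᵀ * N) *ᵥ y := by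
  rw [← Matrix.mulVec_mulVec, Matrix.dotProduct_mulVec x, Matrix.vecMul_transpose]

theorem mulVec_dotProduct_self_le (M : Matrix (Fin m) (Fin n) ℝ) (u : Fin n → ℝ) :
    (M *ᵥ u) ⬝ᵥ (M *ᵥ u) ≤ (Mᵀ * M).trace * (u ⬝ᵥ u) := by
  have h : (Mᵀ * M).trace = ∑ i, ∑ j, M i j ^ 2 := by
    rw [Finset.sum_comm]
    simp [Matrix.trace, Matrix.mul_apply, pow_two]
  rw [h, Finset.sum_mul]
  refine Finset.sum_le_sum fun i _ => ?_
  have := Finset.sum_mul_sq_le_sq_mul_sq Finset.univ (M i) u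
  simpa [Matrix.mulVec, dotProduct, pow_two] using this

theorem mul_trace_gram_le_of_le {C : Matrix (Fin m) (Fin n) ℝ} {c : ℝ}
    (h : ∀ u, c * (u ⬝ᵥ u) ≤ (C *ᵥ u) ⬝ᵥ (C *ᵥ u)) (N : Matrix (Fin n) (Fin p) ℝ) :
    c * (Nᵀ * N).trace ≤ ((C * N)ᵀ * (C * N)).trace := by
  rw [trace_transpose_mul_eq_sum, trace_transpose_mul_eq_sum, Finset.mul_sum]
  exact Finset.sum_le_sum fun j _ => by rw [col_mul]; exact h _

end Frobenius

/-! ### Quadratic form of `A` on and off the dominant subspace. -/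

section Spectral

variable {n p : ℕ} {A : Matrix (Fin n) (Fin n) ℝ}

/-- Parseval's identity is the only form in which orthonormality and completeness of the eigenbasis
are used below. -/
theorem exists_eigenbasis (hA : A.IsHermitian) :
    ∃ u : Fin n → Fin n → ℝ, (∀ i, A *ᵥ u i = eig hA i • u i) ∧
      ∀ x y, x ⬝ᵥ y = ∑ i, (u i ⬝ᵥ x) * (u i ⬝ᵥ y) := by
  have hT := Matrix.isSymmetric_toEuclideanLin_iff.2 hA
  let b := hT.eigenvectorBasis finrank_euclideanSpace_fin
  refine ⟨fun i => (b i).ofLp, fun i => ?_, fun x y => ?_⟩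
  · have := congrArg WithLp.ofLp (hT.apply_eigenvectorBasis finrank_euclideanSpace_fin i)
    exact this
  · have := b.sum_inner_mul_inner (WithLp.toLp 2 x) (WithLp.toLp 2 y)
    simp only [EuclideanSpace.inner_eq_star_dotProduct, star_trivial] at this
    rw [dotProduct_comm, ← this]
    refine Finset.sum_congr rfl fun i _ => ?_
    rw [dotProduct_comm y]

theorem dotProduct_mulVec_symm (hA : A.IsHermitian) (x y : Fin n → ℝ) :
    x ⬝ᵥ A *ᵥ y = (A *ᵥ x) ⬝ᵥ y := by
  have h : Aᵀ = A := by simpa using hA.eq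
  rw [Matrix.dotProduct_mulVec, ← Matrix.mulVec_transpose, h]

theorem quadForm_eq_sum (hA : A.IsHermitian) {u : Fin n → Fin n → ℝ}
    (hu : ∀ i, A *ᵥ u i = eig hA i • u i)
    (hP : ∀ x y, x ⬝ᵥ y = ∑ i, (u i ⬝ᵥ x) * (u i ⬝ᵥ y)) (z : Fin n → ℝ) :
    z ⬝ᵥ A *ᵥ z = ∑ i, eig hA i * (u i ⬝ᵥ z) ^ 2 := by
  rw [hP]
  refine Finset.sum_congr rfl fun i _ => ?_
  rw [dotProduct_mulVec_symm hA, hu, smul_dotProduct, smul_eq_mul]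
  ring

theorem quadForm_le_of_support (hA : A.IsHermitian) {u : Fin n → Fin n → ℝ}
    (hu : ∀ i, A *ᵥ u i = eig hA i • u i)
    (hP : ∀ x y, x ⬝ᵥ y = ∑ i, (u i ⬝ᵥ x) * (u i ⬝ᵥ y)) {z : Fin n → ℝ} {c : ℝ}
    (h : ∀ i, u i ⬝ᵥ z ≠ 0 → eig hA i ≤ c) : z ⬝ᵥ A *ᵥ z ≤ c * (z ⬝ᵥ z) := by
  rw [quadForm_eq_sum hA hu hP, hP z z, Finset.mul_sum]
  refine Finset.sum_le_sum fun i _ => ?_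
  by_cases hi : u i ⬝ᵥ z = 0
  · simp [hi]
  · rw [← pow_two]
    exact mul_le_mul_of_nonneg_right (h i hi) (sq_nonneg _)

theorem le_quadForm_of_support (hA : A.IsHermitian) {u : Fin n → Fin n → ℝ}
    (hu : ∀ i, A *ᵥ u i = eig hA i • u i)
    (hP : ∀ x y, x ⬝ᵥ y = ∑ i, (u i ⬝ᵥ x) * (u i ⬝ᵥ y)) {z : Fin n → ℝ} {c : ℝ}
    (h : ∀ i, u i ⬝ᵥ z ≠ 0 → c ≤ eig hA i) : c * (z ⬝ᵥ z) ≤ z ⬝ᵥ A *ᵥ z := by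
  rw [quadForm_eq_sum hA hu hP, hP z z, Finset.mul_sum]
  refine Finset.sum_le_sum fun i _ => ?_
  by_cases hi : u i ⬝ᵥ z = 0
  · simp [hi]
  · rw [← pow_two]
    exact mul_le_mul_of_nonneg_right (h i hi) (sq_nonneg _)

theorem quadForm_le_eig_first (hA : A.IsHermitian) (h0 : 0 < n) (z : Fin n → ℝ) :
    z ⬝ᵥ A *ᵥ z ≤ eig hA ⟨0, h0⟩ * (z ⬝ᵥ z) := by
  obtain ⟨u, hu, hP⟩ := exists_eigenbasis hA
  exact quadForm_le_of_support hA hu hP fun i _ => eig_antitone hA (Fin.mk_le_of_le_val (by simp))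

theorem eig_last_le_quadForm (hA : A.IsHermitian) (h0 : n - 1 < n) (z : Fin n → ℝ) :
    eig hA ⟨n - 1, h0⟩ * (z ⬝ᵥ z) ≤ z ⬝ᵥ A *ᵥ z := by
  obtain ⟨u, hu, hP⟩ := exists_eigenbasis hA
  refine le_quadForm_of_support hA hu hP fun i _ => eig_antitone hA ?_
  rw [Fin.le_def]
  simp only
  omega

theorem IsDominantBasis.mul_eq {hA : A.IsHermitian} {hpn : p < n} {V : Matrix (Fin n) (Fin p) ℝ}
    (hV : IsDominantBasis hA hpn V) : A * V = V * (Vᵀ * A * V) := by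
  obtain ⟨hV1, hR⟩ := hV
  have hinv : LinearMap.range (Matrix.toLin' V) ≤
      (LinearMap.range (Matrix.toLin' V)).comap (Matrix.toLin' A) := by
    conv_lhs => rw [hR]
    refine iSup_le fun i x hx => ?_
    rw [Submodule.mem_comap, Module.End.mem_eigenspace_iff.1 hx, hR]
    exact Submodule.smul_mem _ _ (Submodule.mem_iSup_of_mem i hx)
  refine Matrix.toLin'.injective (LinearMap.ext fun y => ?_)
  obtain ⟨w, hw⟩ := hinv ⟨y, rfl⟩
  simp only [Matrix.toLin'_apply, ← Matrix.mulVec_mulVec] at hw ⊢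
  rw [← hw, Matrix.mulVec_mulVec w Vᵀ V, show Vᵀ * V = 1 from hV1, Matrix.one_mulVec]

theorem IsDominantBasis.le_quadForm {hA : A.IsHermitian} {hpn : p < n} (hp : p - 1 < n)
    {V : Matrix (Fin n) (Fin p) ℝ} (hV : IsDominantBasis hA hpn V) (y : Fin p → ℝ) :
    eig hA ⟨p - 1, hp⟩ * ((V *ᵥ y) ⬝ᵥ (V *ᵥ y)) ≤ (V *ᵥ y) ⬝ᵥ A *ᵥ (V *ᵥ y) := by
  obtain ⟨u, hu, hP⟩ := exists_eigenbasis hA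
  refine le_quadForm_of_support hA hu hP fun i hi => ?_
  by_contra! hlt
  have hip : (⟨p, hpn⟩ : Fin n) ≤ i := by
    by_contra! h
    refine absurd (eig_antitone hA (a := i) (b := ⟨p - 1, hp⟩) ?_) (not_le.2 hlt)
    rw [Fin.lt_def] at h
    rw [Fin.le_def]
    simp only at h ⊢
    omega
  -- Eigenvectors for distinct eigenvalues are orthogonal, so `u i` is orthogonal to every
  -- eigenspace making up the range of `V`.
  have hle : LinearMap.range (Matrix.toLin' V) ≤ LinearMap.ker (dotProductBilin ℝ ℝ (u i)) := by
    rw [hV.2]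
    refine iSup_le fun j x hx => ?_
    have hx' : A *ᵥ x = eig hA (Fin.castLE hpn.le j) • x := by
      simpa using Module.End.mem_eigenspace_iff.1 hx
    have h1 := dotProduct_mulVec_symm hA (u i) x
    rw [hx', hu, smul_dotProduct, dotProduct_smul, smul_eq_mul, smul_eq_mul] at h1
    have h2 : eig hA ⟨p - 1, hp⟩ ≤ eig hA (Fin.castLE hpn.le j) :=
      eig_antitone hA (by rw [Fin.le_def]; simp only [Fin.val_castLE]; omega)
    have h3 := eig_antitone hA hip
    have h4 : (eig hA (Fin.castLE hpn.le j) - eig hA i) * (u i ⬝ᵥ x) = 0 := by linarith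
    rcases mul_eq_zero.1 h4 with h | h
    · linarith
    · simpa using h
  exact hi (by simpa using hle ⟨y, rfl⟩)

theorem IsDominantBasis.quadForm_le {hA : A.IsHermitian} {hpn : p < n}
    {V : Matrix (Fin n) (Fin p) ℝ} (hV : IsDominantBasis hA hpn V) {z : Fin n → ℝ}
    (hz : Vᵀ *ᵥ z = 0) : z ⬝ᵥ A *ᵥ z ≤ eig hA ⟨p, hpn⟩ * (z ⬝ᵥ z) := by
  obtain ⟨u, hu, hP⟩ := exists_eigenbasis hA
  refine quadForm_le_of_support hA hu hP fun i hi => ?_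
  by_contra! hlt
  have hip : (i : ℕ) < p := by
    by_contra! h
    exact absurd (eig_antitone hA (Fin.le_def.2 h : (⟨p, hpn⟩ : Fin n) ≤ i)) (not_le.2 hlt)
  have hmem : u i ∈ LinearMap.range (Matrix.toLin' V) := by
    rw [hV.2]
    refine Submodule.mem_iSup_of_mem ⟨i, hip⟩ (Module.End.mem_eigenspace_iff.2 ?_)
    simpa using hu i
  obtain ⟨w, hw⟩ := hmem
  refine hi ?_
  rw [← hw, Matrix.toLin'_apply, ← Matrix.vecMul_transpose, ← Matrix.dotProduct_mulVec, hz,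
    dotProduct_zero]

end Spectral

/-! ### Quadratic growth, gradient dominance and principal angles. -/

section Subspaces

variable {n p : ℕ} {A : Matrix (Fin n) (Fin n) ℝ} {V X : Matrix (Fin n) (Fin p) ℝ}

/-- The sum of the squared sines of the principal angles between the spans of `X` and `V`. -/
def sinSq (X V : Matrix (Fin n) (Fin p) ℝ) : ℝ :=
  p - ((Vᵀ * X)ᵀ * (Vᵀ * X)).trace

theorem gram_sub_proj (hX : X ∈ stiefel n p) (V : Matrix (Fin n) (Fin p) ℝ) :
    (V - X * (Xᵀ * V))ᵀ * (V - X * (Xᵀ * V)) = Vᵀ * V - (Xᵀ * V)ᵀ * (Xᵀ * V) := by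
  have hX' : Xᵀ * X = 1 := hX
  have h (M : Matrix (Fin p) (Fin p) ℝ) : Xᵀ * (X * M) = M := by
    rw [← Matrix.mul_assoc, hX', Matrix.one_mul]
  simp only [transpose_sub, transpose_mul, transpose_transpose, Matrix.sub_mul, Matrix.mul_sub,
    Matrix.mul_assoc, h]
  abel

theorem trace_gram_sub_proj (hV : V ∈ stiefel n p) (hX : X ∈ stiefel n p) :
    ((X - V * (Vᵀ * X))ᵀ * (X - V * (Vᵀ * X))).trace = sinSq X V := by
  rw [gram_sub_proj hV, show Xᵀ * X = 1 from hX, trace_sub, trace_one, Fintype.card_fin, sinSq]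

theorem sinSq_comm (X V : Matrix (Fin n) (Fin p) ℝ) : sinSq X V = sinSq V X := by
  rw [sinSq, sinSq, trace_mul_comm]
  simp

theorem sinSq_nonneg (hV : V ∈ stiefel n p) (hX : X ∈ stiefel n p) : 0 ≤ sinSq X V := by
  rw [← trace_gram_sub_proj hV hX]
  exact trace_gram_nonneg _

/-- Invariance removes the cross terms of `A` between span `V` and its complement. In the first
trace the columns lie in span `V`, in the second they are orthogonal to it, and both matrices have
squared norm `sinSq X V`; bounding `A` on each part then gives both growth estimates. -/
theorem phi_sub_phi_eq (hA : A.IsHermitian) (hV : V ∈ stiefel n p)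
    (hAV : A * V = V * (Vᵀ * A * V)) (hX : X ∈ stiefel n p) :
    2 * (phi A X - phi A V) =
      ((V * (V - X * (Xᵀ * V))ᵀ)ᵀ * A * (V * (V - X * (Xᵀ * V))ᵀ)).trace -
        ((X - V * (Vᵀ * X))ᵀ * A * (X - V * (Vᵀ * X))).trace := by
  have hAt : Aᵀ = A := by simpa using hA.eq
  set B := Vᵀ * A * V with hB
  have hVA : Vᵀ * A = B * Vᵀ := by
    have := congrArg transpose hAV
    simpa [hB, hAt, Matrix.mul_assoc] using this
  have hV' : Vᵀ * V = 1 := hV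
  have e1 : ((V * (V - X * (Xᵀ * V))ᵀ)ᵀ * A * (V * (V - X * (Xᵀ * V))ᵀ)).trace =
      B.trace - ((Vᵀ * X)ᵀ * B * (Vᵀ * X)).trace := by
    set T := V - X * (Xᵀ * V) with hT
    have : (V * Tᵀ)ᵀ * A * (V * Tᵀ) = T * (B * Tᵀ) := by
      rw [hB]
      simp only [transpose_mul, transpose_transpose, Matrix.mul_assoc]
    rw [this, trace_mul_comm, Matrix.mul_assoc, hT, gram_sub_proj hX, hV', Matrix.mul_sub,
      trace_sub, Matrix.mul_one]
    congr 1
    rw [Matrix.mul_assoc (Vᵀ * X)ᵀ, trace_mul_comm (Vᵀ * X)ᵀ]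
    simp [Matrix.mul_assoc]
  have e2 : (X - V * (Vᵀ * X))ᵀ * A * (X - V * (Vᵀ * X)) =
      Xᵀ * A * X - (Vᵀ * X)ᵀ * B * (Vᵀ * X) := by
    have h1 : A * (V * (Vᵀ * X)) = V * (B * (Vᵀ * X)) := by
      rw [← Matrix.mul_assoc, hAV, Matrix.mul_assoc]
    have h2 : Vᵀ * (A * X) = B * (Vᵀ * X) := by
      rw [← Matrix.mul_assoc, hVA, Matrix.mul_assoc]
    have h3 (M : Matrix (Fin p) (Fin p) ℝ) : Vᵀ * (V * M) = M := by
      rw [← Matrix.mul_assoc, hV', Matrix.one_mul]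
    simp only [transpose_sub, transpose_mul, transpose_transpose, Matrix.sub_mul, Matrix.mul_sub,
      Matrix.mul_assoc, h1, h2, h3]
    abel
  rw [e1, e2, trace_sub, phi, phi]
  ring

theorem trace_gram_mul_sub_proj (hV : V ∈ stiefel n p) (hX : X ∈ stiefel n p) :
    ((V * (V - X * (Xᵀ * V))ᵀ)ᵀ * (V * (V - X * (Xᵀ * V))ᵀ)).trace = sinSq X V := by
  rw [sinSq_comm, ← trace_gram_sub_proj hX hV]
  set T := V - X * (Xᵀ * V)
  have : (V * Tᵀ)ᵀ * (V * Tᵀ) = T * ((Vᵀ * V) * Tᵀ) := by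
    simp only [transpose_mul, transpose_transpose, Matrix.mul_assoc]
  rw [this, show Vᵀ * V = 1 from hV, Matrix.one_mul, trace_mul_comm]

theorem transpose_mulVec_col_sub_proj (hV : V ∈ stiefel n p) (X : Matrix (Fin n) (Fin p) ℝ)
    (j : Fin p) : Vᵀ *ᵥ (X - V * (Vᵀ * X)).col j = 0 := by
  rw [← col_mul, Matrix.mul_sub, ← Matrix.mul_assoc, show Vᵀ * V = 1 from hV, Matrix.one_mul,
    sub_self]
  rfl

theorem gap_mul_sinSq_le {hA : A.IsHermitian} {hpn : p < n} (hp : p - 1 < n)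
    (hV : IsDominantBasis hA hpn V) (hX : X ∈ stiefel n p) :
    (eig hA ⟨p - 1, hp⟩ - eig hA ⟨p, hpn⟩) * sinSq X V ≤ 2 * (phi A X - phi A V) := by
  rw [phi_sub_phi_eq hA hV.1 hV.mul_eq hX, sub_mul]
  refine sub_le_sub ?_ ?_
  · rw [← trace_gram_mul_sub_proj hV.1 hX]
    refine le_trace_conj_of_le fun j => ?_
    rw [col_mul]
    exact hV.le_quadForm hp _
  · rw [← trace_gram_sub_proj hV.1 hX]
    exact trace_conj_le_of_le fun j => hV.quadForm_le (transpose_mulVec_col_sub_proj hV.1 X j)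

theorem phi_sub_phi_le {hA : A.IsHermitian} {hpn : p < n}
    (hV : IsDominantBasis hA hpn V) (hX : X ∈ stiefel n p) {a b : ℝ}
    (hb : ∀ z, z ⬝ᵥ A *ᵥ z ≤ b * (z ⬝ᵥ z)) (ha : ∀ z, a * (z ⬝ᵥ z) ≤ z ⬝ᵥ A *ᵥ z) :
    2 * (phi A X - phi A V) ≤ (b - a) * sinSq X V := by
  rw [phi_sub_phi_eq hA hV.1 hV.mul_eq hX, sub_mul]
  refine sub_le_sub ?_ ?_
  · rw [← trace_gram_mul_sub_proj hV.1 hX]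
    exact trace_conj_le_of_le fun j => hb _
  · rw [← trace_gram_sub_proj hV.1 hX]
    exact le_trace_conj_of_le fun j => ha _

theorem phiStar_eq_phi {hA : A.IsHermitian} {hpn : p < n} (hp : p - 1 < n)
    (hV : IsDominantBasis hA hpn V) (hgap : eig hA ⟨p, hpn⟩ ≤ eig hA ⟨p - 1, hp⟩) :
    phiStar A p = phi A V := by
  refine IsLeast.csInf_eq ⟨⟨V, hV.1, rfl⟩, ?_⟩
  rintro _ ⟨X, hX, rfl⟩
  have h1 := gap_mul_sinSq_le hp hV hX
  have h2 := mul_nonneg (sub_nonneg.2 hgap) (sinSq_nonneg hV.1 hX)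
  linarith

/-- Pythagoras: the part of `X u` outside span `V` has squared norm at most `sinSq X V * ‖u‖²`,
since the Frobenius norm dominates the operator norm. -/
theorem one_sub_sinSq_mul_le (hV : V ∈ stiefel n p) (hX : X ∈ stiefel n p) (u : Fin p → ℝ) :
    (1 - sinSq X V) * (u ⬝ᵥ u) ≤ ((Vᵀ * X) *ᵥ u) ⬝ᵥ ((Vᵀ * X) *ᵥ u) := by
  have h := mulVec_dotProduct_self_le (X - V * (Vᵀ * X)) u
  rw [trace_gram_sub_proj hV hX, mulVec_dotProduct_mulVec, gram_sub_proj hV,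
    show Xᵀ * X = 1 from hX, sub_mulVec, one_mulVec, dotProduct_sub,
    ← mulVec_dotProduct_mulVec] at h
  linarith

/-- Cauchy–Schwarz between the gradient and a tangent vector `Z` at `X` that points to span `V`. The
pairing is exactly `-2 (φ(X) - φ(V))`, and `‖Z‖² ≤ s / (1 - s)`. -/
theorem gradient_dominance_sq (hA : A.IsHermitian) (hV : V ∈ stiefel n p)
    (hAV : A * V = V * (Vᵀ * A * V)) (hX : X ∈ stiefel n p) (hs : sinSq X V < 1) :
    (1 - sinSq X V) * (2 * (phi A X - phi A V)) ^ 2 ≤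
      sinSq X V * ((gradPhi A X)ᵀ * gradPhi A X).trace := by
  have hV' : Vᵀ * V = 1 := hV
  have hX' : Xᵀ * X = 1 := hX
  have hAt : Aᵀ = A := by simpa using hA.eq
  set s := sinSq X V with hsdef
  set C := Vᵀ * X with hC
  set B := Vᵀ * A * V with hB
  have hVA : Vᵀ * A = B * Vᵀ := by
    have := congrArg transpose hAV
    simpa [hB, hAt, Matrix.mul_assoc] using this
  have hCu : ∀ u, (1 - s) * (u ⬝ᵥ u) ≤ (C *ᵥ u) ⬝ᵥ (C *ᵥ u) := one_sub_sinSq_mul_le hV hX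
  have hCunit : IsUnit C := by
    refine Matrix.mulVec_injective_iff_isUnit.1 ((injective_iff_map_eq_zero C.mulVecLin).2 ?_)
    intro u hu
    have h1 := hCu u
    rw [show C *ᵥ u = 0 from hu, dotProduct_zero] at h1
    have h2 := dotProduct_self_nonneg' u
    exact dotProduct_self_eq_zero.1 (by nlinarith)
  have hdet : IsUnit C.det := (Matrix.isUnit_iff_isUnit_det C).1 hCunit
  have hCC : C * C⁻¹ = 1 := Matrix.mul_nonsing_inv C hdet
  have hCC' : C⁻¹ * C = 1 := Matrix.nonsing_inv_mul C hdet
  -- `V C⁻ᵀ` is the basis of span `V` whose projection onto span `X` is `X` itself, hence `Xᵀ Z =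
  -- 0`.
  set Z := V * (C⁻¹)ᵀ - X with hZ
  set T := V - X * (Xᵀ * V) with hT
  have hCt : Xᵀ * V = Cᵀ := by rw [hC, transpose_mul, transpose_transpose]
  have hCtC : Cᵀ * (C⁻¹)ᵀ = 1 := by rw [← transpose_mul, hCC', transpose_one]
  have hZT : Zᵀ = C⁻¹ * Tᵀ := by
    rw [← transpose_transpose (C⁻¹), ← transpose_mul, hT, Matrix.sub_mul, Matrix.mul_assoc, hCt,
      hCtC, Matrix.mul_one]
  have hZX : Zᵀ * X = 0 := by
    rw [hZ, transpose_sub, transpose_mul, transpose_transpose, Matrix.sub_mul, Matrix.mul_assoc,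
      ← hC, hCC', hX', sub_self]
  have hZZ : (1 - s) * (Zᵀ * Z).trace ≤ s := by
    have h := mul_trace_gram_le_of_le hCu (C⁻¹ * Tᵀ)
    rw [← Matrix.mul_assoc C, hCC, Matrix.one_mul, ← hZT, transpose_transpose, transpose_transpose,
      trace_mul_comm, trace_mul_comm T, trace_gram_sub_proj hX hV, sinSq_comm V X] at h
    exact h
  have hZG : (Zᵀ * gradPhi A X).trace = -(2 * (phi A X - phi A V)) := by
    have h1 : Zᵀ * gradPhi A X = -(Zᵀ * A * X) := by
      rw [gradPhi, Matrix.mul_neg, Matrix.mul_sub, ← Matrix.mul_assoc Zᵀ X, hZX, Matrix.zero_mul,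
        sub_zero, Matrix.mul_assoc]
    have h2 : Zᵀ * A * X = C⁻¹ * (B * C) - Xᵀ * A * X := by
      rw [hZ, transpose_sub, transpose_mul, transpose_transpose, Matrix.sub_mul, Matrix.sub_mul,
        Matrix.mul_assoc C⁻¹, hVA, Matrix.mul_assoc, Matrix.mul_assoc B]
    rw [h1, h2, trace_neg, trace_sub, trace_mul_comm, Matrix.mul_assoc, hCC, Matrix.mul_one,
      phi, phi]
    ring
  have hCS := trace_transpose_mul_sq_le Z (gradPhi A X)
  rw [hZG, neg_sq] at hCS
  calc _ ≤ (1 - s) * ((Zᵀ * Z).trace * ((gradPhi A X)ᵀ * gradPhi A X).trace) :=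
        mul_le_mul_of_nonneg_left hCS (by linarith)
    _ = (1 - s) * (Zᵀ * Z).trace * ((gradPhi A X)ᵀ * gradPhi A X).trace := by ring
    _ ≤ _ := mul_le_mul_of_nonneg_right hZZ (trace_gram_nonneg _)

theorem gradient_dominance {hA : A.IsHermitian} {hpn : p < n} (hp : p - 1 < n)
    (hV : IsDominantBasis hA hpn V) (hX : X ∈ stiefel n p)
    (hgap : 0 < eig hA ⟨p - 1, hp⟩ - eig hA ⟨p, hpn⟩) (hs : sinSq X V ≤ 1 / 2) :
    (eig hA ⟨p - 1, hp⟩ - eig hA ⟨p, hpn⟩) * (phi A X - phi A V) ≤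
      ((gradPhi A X)ᵀ * gradPhi A X).trace := by
  have h1 := gradient_dominance_sq hA hV.1 hV.mul_eq hX (by linarith)
  have h2 := gap_mul_sinSq_le hp hV hX
  have h3 := sinSq_nonneg hV.1 hX
  have hG := trace_gram_nonneg (gradPhi A X)
  set s := sinSq X V
  set e := phi A X - phi A V
  set g := ((gradPhi A X)ᵀ * gradPhi A X).trace
  set δ := eig hA ⟨p - 1, hp⟩ - eig hA ⟨p, hpn⟩
  have h4 : 0 ≤ e := by nlinarith
  rcases h4.eq_or_lt with h | h
  · rw [← h]
    linarith
  -- `2 δ e² ≤ δ s g ≤ 2 e g`, from `1 - s ≥ 1/2` and then `δ s ≤ 2 e`; the factor `e > 0` cancels.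
  · have h5 : e * (2 * δ * e) ≤ e * (2 * g) := by
      have i1 : δ * (1 / 2 * (2 * e) ^ 2) ≤ δ * ((1 - s) * (2 * e) ^ 2) :=
        mul_le_mul_of_nonneg_left
          (mul_le_mul_of_nonneg_right (by linarith) (sq_nonneg _)) hgap.le
      have i2 := mul_le_mul_of_nonneg_left h1 hgap.le
      have i3 := mul_le_mul_of_nonneg_right h2 hG
      nlinarith
    have h6 := le_of_mul_le_mul_left h5 h
    linarith

theorem sum_sq_singularValues (C : Matrix (Fin p) (Fin p) ℝ) :
    ∑ i : Fin p, (Matrix.toEuclideanLin C).singularValues i ^ 2 = (Cᵀ * C).trace := by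
  set T := Matrix.toEuclideanLin C with hT
  have h1 : ∑ i : Fin p, T.singularValues i ^ 2 =
      LinearMap.trace ℝ _ (LinearMap.adjoint T ∘ₗ T) := by
    rw [T.isSymmetric_adjoint_comp_self.trace_eq_sum_eigenvalues finrank_euclideanSpace_fin]
    exact Finset.sum_congr rfl fun i _ => T.sq_singularValues_fin finrank_euclideanSpace_fin i
  rw [h1, LinearMap.trace_eq_sum_inner _ (EuclideanSpace.basisFun (Fin p) ℝ)]
  simp only [LinearMap.comp_apply, LinearMap.adjoint_inner_right]
  refine Finset.sum_congr rfl fun i _ => ?_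
  rw [real_inner_self_eq_norm_sq, EuclideanSpace.real_norm_sq_eq]
  simp [hT, Matrix.mul_apply, pow_two]

theorem one_sub_sq_le_arccos_sq {x : ℝ} (hx : 0 ≤ x) : 1 - x ^ 2 ≤ Real.arccos x ^ 2 := by
  rcases le_or_gt x 1 with h | h
  · have h1 := Real.sin_arccos x
    have h2 : Real.sin (Real.arccos x) ^ 2 = 1 - x ^ 2 := by
      rw [h1, Real.sq_sqrt (by nlinarith)]
    rw [← h2]
    exact pow_le_pow_left₀ (by rw [h1]; exact Real.sqrt_nonneg _)
      (Real.sin_le (Real.arccos_nonneg x)) 2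
  -- For `x > 1` the left side is negative, so no upper bound on singular values is needed.
  · nlinarith [sq_nonneg (Real.arccos x)]

theorem sinSq_le_grassmannDist_sq (X V : Matrix (Fin n) (Fin p) ℝ) :
    sinSq X V ≤ grassmannDist X V ^ 2 := by
  rw [grassmannDist, Real.sq_sqrt (Finset.sum_nonneg fun i _ => sq_nonneg _), sinSq,
    ← sum_sq_singularValues]
  calc _ = ∑ i : Fin p, (1 - (Matrix.toEuclideanLin (Vᵀ * X)).singularValues i ^ 2) := by
        simp
    _ ≤ _ := Finset.sum_le_sum fun i _ =>
        one_sub_sq_le_arccos_sq (LinearMap.singularValues_nonneg _ _)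

end Subspaces

/-! ### Sufficient decrease of one line-search step. -/

section Step

variable {n p : ℕ} {A : Matrix (Fin n) (Fin n) ℝ} {X X' : Matrix (Fin n) (Fin p) ℝ}

theorem transpose_mul_gradPhi (hX : X ∈ stiefel n p) (A : Matrix (Fin n) (Fin n) ℝ) :
    Xᵀ * gradPhi A X = 0 := by
  rw [gradPhi, Matrix.mul_neg, Matrix.mul_sub, ← Matrix.mul_assoc Xᵀ X, show Xᵀ * X = 1 from hX,
    Matrix.one_mul, Matrix.mul_assoc, sub_self, neg_zero]

theorem gradPhi_gram (hX : X ∈ stiefel n p) (A : Matrix (Fin n) (Fin n) ℝ) :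
    (gradPhi A X)ᵀ * gradPhi A X = -((gradPhi A X)ᵀ * A * X) := by
  have h : (gradPhi A X)ᵀ * X = 0 := by
    simpa using congrArg transpose (transpose_mul_gradPhi hX A)
  nth_rw 2 [gradPhi]
  rw [Matrix.mul_neg, Matrix.mul_sub, ← Matrix.mul_assoc _ X, h, Matrix.zero_mul, sub_zero,
    Matrix.mul_assoc]

theorem conj_apply_eq (M N : Matrix (Fin n) (Fin p) ℝ) (i j : Fin p) :
    (Mᵀ * A * N) i j = M.col i ⬝ᵥ A *ᵥ N.col j := by
  rw [Matrix.mul_assoc, Matrix.mul_apply]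
  refine Finset.sum_congr rfl fun k _ => ?_
  rw [← col_mul]
  simp [Matrix.col_apply]

theorem gram_apply_eq (M N : Matrix (Fin n) (Fin p) ℝ) (i j : Fin p) :
    (Mᵀ * N) i j = M.col i ⬝ᵥ N.col j := by
  simp [Matrix.mul_apply, dotProduct, Matrix.col_apply]

/-- The off-diagonal block of a symmetric matrix has norm at most half its spectral width. -/
theorem sq_norm_le_of_orthogonal (hA : A.IsHermitian) {a b β : ℝ} (hab : 0 < b - a)
    (hb : ∀ z, z ⬝ᵥ A *ᵥ z ≤ b * (z ⬝ᵥ z)) (ha : ∀ z, a * (z ⬝ᵥ z) ≤ z ⬝ᵥ A *ᵥ z)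
    {x g : Fin n → ℝ} (hx : x ⬝ᵥ x = 1) (hxg : x ⬝ᵥ g = 0) (hg : g ⬝ᵥ g = β)
    (hgx : g ⬝ᵥ A *ᵥ x = -β) : β ≤ (b - a) ^ 2 / 4 := by
  have hxAg : x ⬝ᵥ A *ᵥ g = -β := by rw [dotProduct_mulVec_symm hA, dotProduct_comm, hgx]
  have hgx0 : g ⬝ᵥ x = 0 := by rw [dotProduct_comm, hxg]
  have e1 (t : ℝ) : (x + t • g) ⬝ᵥ A *ᵥ (x + t • g) =
      x ⬝ᵥ A *ᵥ x - 2 * t * β + t ^ 2 * (g ⬝ᵥ A *ᵥ g) := by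
    simp only [mulVec_add, mulVec_smul, add_dotProduct, dotProduct_add, smul_dotProduct,
      dotProduct_smul, hgx, hxAg, smul_eq_mul]
    ring
  have e2 (t : ℝ) : (x + t • g) ⬝ᵥ (x + t • g) = 1 + t ^ 2 * β := by
    simp only [add_dotProduct, dotProduct_add, smul_dotProduct, dotProduct_smul, hx, hg, hxg, hgx0,
      smul_eq_mul]
    ring
  -- Comparing the form at `x - t g` (at most `b`) and at `x + t g` (at least `a`) gives `4 t β ≤ L
  -- (1 + t² β)`; `t = 2 / L` yields the bound.
  set L := b - a with hL
  have h1 := hb (x + (-(2 / L)) • g)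
  have h2 := ha (x + (2 / L) • g)
  rw [e1, e2] at h1 h2
  have h3 : 8 * β / L ≤ L * (1 + (2 / L) ^ 2 * β) := by
    have : 8 * β / L = 4 * (2 / L) * β := by ring
    rw [this, hL]
    linarith
  have h4 : L * (1 + (2 / L) ^ 2 * β) = L + 4 * β / L := by
    field_simp
    ring
  rw [h4] at h3
  have h5 : 4 * β / L ≤ L := by
    have : 8 * β / L = 4 * β / L + 4 * β / L := by ring
    linarith
  rw [div_le_iff₀ hab] at h5
  linarith

/-- With `L = b - a`, `γ ≥ (α - L) β` makes the numerator at least `α (1 + β / L²) + β / L`. The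
denominator `1 + β / L²` is at most `5/4`, the source of the factor `4/5`. -/
theorem lineSearch_term_ge {α β γ a b : ℝ} (hab : 0 < b - a) (hβ0 : 0 ≤ β)
    (hβ : β ≤ (b - a) ^ 2 / 4) (hα : α ≤ b) (hγ : a * β ≤ γ) :
    α + 4 / (5 * (b - a)) * β ≤
      (α + 2 * β * (1 / (b - a)) + γ * (1 / (b - a)) ^ 2) / (1 + β * (1 / (b - a)) ^ 2) := by
  rw [le_div_iff₀ (by positivity)]
  set L := b - a with hL
  have h1 : (α - L) * β ≤ γ := by nlinarith
  have h2 : (α - L) * β * (1 / L) ^ 2 ≤ γ * (1 / L) ^ 2 :=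
    mul_le_mul_of_nonneg_right h1 (sq_nonneg _)
  have h3 : L * β * (1 / L) ^ 2 = β * (1 / L) := by field_simp
  have h4 : β * (1 / L) ^ 2 ≤ 1 / 4 := by
    have := mul_le_mul_of_nonneg_right hβ (sq_nonneg (1 / L))
    have e : L ^ 2 / 4 * (1 / L) ^ 2 = 1 / 4 := by field_simp
    linarith
  have h5 : 4 / (5 * L) * β = 4 / 5 * (β * (1 / L)) := by field_simp
  have h6 : 0 ≤ β * (1 / L) := by positivity
  have h7 := mul_le_mul_of_nonneg_left h4 h6
  rw [h5]
  nlinarith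

theorem GDStep.mem_stiefel_and_phi_le (hA : A.IsHermitian) (h : GDStep A X X') (hX : X ∈ stiefel n p) {a b : ℝ}
    (hab : 0 < b - a) (hb : ∀ z, z ⬝ᵥ A *ᵥ z ≤ b * (z ⬝ᵥ z))
    (ha : ∀ z, a * (z ⬝ᵥ z) ≤ z ⬝ᵥ A *ᵥ z) :
    X' ∈ stiefel n p ∧
    phi A X' ≤ phi A X - 2 / (5 * (b - a)) * ((gradPhi A X)ᵀ * gradPhi A X).trace := by
  obtain ⟨V, β, μ, hV, hG, hμ, hmin, rfl⟩ := h
  have hAt : Aᵀ = A := by simpa using hA.eq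
  have hX' : Xᵀ * X = 1 := hX
  have hXG : Xᵀ * gradPhi A X = 0 := transpose_mul_gradPhi hX A
  have hGX : (gradPhi A X)ᵀ * X = 0 := by simpa using congrArg transpose hXG
  have hGAX : (gradPhi A X)ᵀ * A * X = -((gradPhi A X)ᵀ * gradPhi A X) := by
    rw [gradPhi_gram hX, neg_neg]
  have hXAG : Xᵀ * A * gradPhi A X = -((gradPhi A X)ᵀ * gradPhi A X) := by
    simpa [hAt, Matrix.mul_assoc] using congrArg transpose hGAX
  set G := gradPhi A X with hGdef
  have hVV : V * Vᵀ = 1 := (Matrix.mem_orthogonalGroup_iff _ _).1 hV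
  have hVV' : Vᵀ * V = 1 := (Matrix.mem_orthogonalGroup_iff' _ _).1 hV
  have hdiag : Vᵀ * (Gᵀ * G) * V = diagonal β := by
    rw [hG, Matrix.mul_assoc, Matrix.mul_assoc, hVV', Matrix.mul_one, ← Matrix.mul_assoc, hVV',
      Matrix.one_mul]
  have hGV : (G * V)ᵀ * (G * V) = diagonal β := by
    rw [← hdiag, transpose_mul]
    simp only [Matrix.mul_assoc]
  have hXV : (X * V)ᵀ * (X * V) = 1 := by
    rw [transpose_mul, Matrix.mul_assoc, ← Matrix.mul_assoc Xᵀ, hX', Matrix.one_mul, hVV']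
  have hXVGV : (X * V)ᵀ * (G * V) = 0 := by
    rw [transpose_mul, Matrix.mul_assoc, ← Matrix.mul_assoc Xᵀ, hXG, Matrix.zero_mul,
      Matrix.mul_zero]
  have hGVAXV : (G * V)ᵀ * A * (X * V) = -diagonal β := by
    rw [← hdiag, ← Matrix.neg_mul, ← Matrix.mul_neg, ← hGAX, transpose_mul]
    simp only [Matrix.mul_assoc]
  have hXVAGV : (X * V)ᵀ * A * (G * V) = -diagonal β := by
    rw [← hdiag, ← Matrix.neg_mul, ← Matrix.mul_neg, ← hXAG, transpose_mul]
    simp only [Matrix.mul_assoc]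
  have hβG (i : Fin p) : (G * V).col i ⬝ᵥ (G * V).col i = β i := by
    rw [← gram_apply_eq, hGV, diagonal_apply_eq]
  have hβ0 (i : Fin p) : 0 ≤ β i := by
    rw [← hβG]
    exact dotProduct_self_nonneg' _
  have hXi (i : Fin p) : (X * V).col i ⬝ᵥ (X * V).col i = 1 := by
    rw [← gram_apply_eq, hXV, one_apply_eq]
  have hXGi (i : Fin p) : (X * V).col i ⬝ᵥ (G * V).col i = 0 := by
    rw [← gram_apply_eq, hXVGV, Matrix.zero_apply]
  have hGXi (i : Fin p) : (G * V).col i ⬝ᵥ A *ᵥ (X * V).col i = -β i := by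
    rw [← conj_apply_eq, hGVAXV, Matrix.neg_apply, diagonal_apply_eq]
  have hβle (i : Fin p) : β i ≤ (b - a) ^ 2 / 4 :=
    sq_norm_le_of_orthogonal hA hab hb ha (hXi i) (hXGi i) (hβG i) (hGXi i)
  set Y := (X - μ • G) * V with hY
  have hYeq : Y = X * V - μ • (G * V) := by rw [hY, Matrix.sub_mul, Matrix.smul_mul]
  have hGVXV : (G * V)ᵀ * (X * V) = 0 := by
    simpa using congrArg transpose hXVGV
  -- In the basis diagonalizing `Gᵀ G` the trial columns are orthogonal, so the polar retraction
  -- only rescales them and `φ` along the curve is the rational function.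
  have hYY : Yᵀ * Y = diagonal fun i => 1 + μ ^ 2 * β i := by
    rw [hYeq, transpose_sub, transpose_smul, Matrix.sub_mul, Matrix.mul_sub, Matrix.mul_sub,
      Matrix.mul_smul, Matrix.smul_mul, Matrix.smul_mul, Matrix.mul_smul, hXV, hXVGV, hGVXV, hGV]
    ext i j
    by_cases hij : i = j
    · subst hij
      simp
      ring
    · simp [hij]
  set S : Matrix (Fin p) (Fin p) ℝ := diagonal fun i => (√(1 + μ ^ 2 * β i))⁻¹ with hS
  have hpos (i : Fin p) : 0 < 1 + μ ^ 2 * β i := by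
    have := mul_nonneg (sq_nonneg μ) (hβ0 i)
    linarith
  have hSt : Sᵀ = S := diagonal_transpose _
  have hsq (i : Fin p) : (√(1 + μ ^ 2 * β i))⁻¹ * (√(1 + μ ^ 2 * β i))⁻¹ = (1 + μ ^ 2 * β i)⁻¹ := by
    rw [← mul_inv, Real.mul_self_sqrt (hpos i).le]
  have hSS : S * (Yᵀ * Y) * S = 1 := by
    rw [hYY, hS, diagonal_mul_diagonal, diagonal_mul_diagonal, ← diagonal_one]
    congr 1
    funext i
    rw [mul_right_comm, hsq, inv_mul_cancel₀ (hpos i).ne']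
  refine ⟨?_, ?_⟩
  · change (Y * S * Vᵀ)ᵀ * (Y * S * Vᵀ) = 1
    calc _ = V * (S * (Yᵀ * Y) * S) * Vᵀ := by
          simp only [transpose_mul, transpose_transpose, hSt, Matrix.mul_assoc]
      _ = 1 := by rw [hSS, Matrix.mul_one, hVV]
  have hphi : phi A (Y * S * Vᵀ) = lineSearchFun (fun i => ((X * V)ᵀ * A * (X * V)) i i) β
      (fun i => ((G * V)ᵀ * A * (G * V)) i i) μ := by
    have h1 : ((Y * S * Vᵀ)ᵀ * A * (Y * S * Vᵀ)).trace = (S * (Yᵀ * A * Y) * S).trace := by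
      have : (Y * S * Vᵀ)ᵀ * A * (Y * S * Vᵀ) = V * (S * (Yᵀ * A * Y) * S * Vᵀ) := by
        simp only [transpose_mul, transpose_transpose, hSt, Matrix.mul_assoc]
      rw [this, trace_mul_comm, Matrix.mul_assoc, hVV', Matrix.mul_one]
    have h2 : Yᵀ * A * Y = (X * V)ᵀ * A * (X * V) + (2 * μ) • diagonal β +
        μ ^ 2 • ((G * V)ᵀ * A * (G * V)) := by
      rw [hYeq, transpose_sub, transpose_smul, Matrix.sub_mul, Matrix.sub_mul, Matrix.mul_sub,
        Matrix.mul_sub, Matrix.mul_smul, Matrix.smul_mul, Matrix.smul_mul, Matrix.smul_mul,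
        Matrix.mul_smul, hXVAGV, hGVAXV]
      module
    rw [phi, lineSearchFun, h1, h2]
    congr 1
    refine Finset.sum_congr rfl fun i _ => ?_
    rw [diag_apply, hS, mul_diagonal, diagonal_mul, mul_right_comm, hsq]
    simp only [Matrix.add_apply, Matrix.smul_apply, diagonal_apply_eq, smul_eq_mul]
    rw [div_eq_inv_mul, mul_comm (β i) (μ ^ 2)]
    ring
  have hphiX : phi A X = -(1 / 2) * ∑ i, ((X * V)ᵀ * A * (X * V)) i i := by
    have : (X * V)ᵀ * A * (X * V) = Vᵀ * (Xᵀ * A * X * V) := by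
      simp only [transpose_mul, Matrix.mul_assoc]
    change _ = -(1 / 2) * ((X * V)ᵀ * A * (X * V)).trace
    rw [this, trace_mul_comm, Matrix.mul_assoc, hVV, Matrix.mul_one, phi]
  have htr : (Gᵀ * G).trace = ∑ i, β i := by
    rw [hG, trace_mul_comm, ← Matrix.mul_assoc, hVV', Matrix.one_mul, trace_diagonal]
  rw [hphi, hphiX, htr]
  -- The minimizer enters only here, through comparison with the fixed step `1 / L`.
  refine le_trans (hmin (show 1 / (b - a) ∈ Set.Ici 0 from (one_div_pos.2 hab).le)) ?_
  have hsum := Finset.sum_le_sum fun (i : Fin p) (_ : i ∈ Finset.univ) =>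
    lineSearch_term_ge (α := ((X * V)ᵀ * A * (X * V)) i i) (γ := ((G * V)ᵀ * A * (G * V)) i i)
      hab (hβ0 i) (hβle i)
      (by rw [conj_apply_eq]; simpa [hXi i] using hb ((X * V).col i))
      (by rw [conj_apply_eq]; simpa [hβG i] using ha ((G * V).col i))
  rw [Finset.sum_add_distrib, ← Finset.mul_sum] at hsum
  rw [lineSearchFun]
  have e : 4 / (5 * (b - a)) * ∑ i, β i = 2 * (2 / (5 * (b - a)) * ∑ i, β i) := by ring
  rw [e] at hsum
  linarith

end Step

end GrassmannGD

/-! ### Linear convergence. -/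

theorem mainTheorem1 {n p : ℕ} (hp : 0 < p) (hpn : p < n)
    (A : Matrix (Fin n) (Fin n) ℝ) (hA : A.IsHermitian)
    (δ L : ℝ)
    (hδ : δ = GrassmannGD.eig hA ⟨p - 1, by omega⟩ - GrassmannGD.eig hA ⟨p, hpn⟩)
    (hL : L = GrassmannGD.eig hA ⟨0, by omega⟩ - GrassmannGD.eig hA ⟨n - 1, by omega⟩)
    (hgap : 0 < δ)
    (V : Matrix (Fin n) (Fin p) ℝ) (hV : GrassmannGD.IsDominantBasis hA hpn V)
    (X : ℕ → Matrix (Fin n) (Fin p) ℝ) (hX₀ : X 0 ∈ GrassmannGD.stiefel n p)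
    (hdist : GrassmannGD.grassmannDist (X 0) V ≤ √(2 * GrassmannGD.cQ * δ / L))
    (N : ℕ) (hstep : ∀ k < N, GrassmannGD.GDStep A (X k) (X (k + 1))) :
    ∀ k ≤ N, GrassmannGD.phi A (X k) - GrassmannGD.phiStar A p ≤
      (1 - GrassmannGD.cQ * (2 * δ / (5 * L))) ^ k *
        (GrassmannGD.phi A (X 0) - GrassmannGD.phiStar A p) := by
  have hp1 : p - 1 < n := by omega
  have hδL : δ ≤ L := by
    have h1 : GrassmannGD.eig hA ⟨p - 1, hp1⟩ ≤ GrassmannGD.eig hA ⟨0, by omega⟩ :=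
      GrassmannGD.eig_antitone hA (Fin.le_def.2 (Nat.zero_le _))
    have h2 : GrassmannGD.eig hA ⟨n - 1, by omega⟩ ≤ GrassmannGD.eig hA ⟨p, hpn⟩ :=
      GrassmannGD.eig_antitone hA (Fin.le_def.2 (by simp only; omega))
    linarith
  have hLpos : 0 < L := hgap.trans_le hδL
  have hb := GrassmannGD.quadForm_le_eig_first hA (by omega : 0 < n)
  have ha := GrassmannGD.eig_last_le_quadForm hA (by omega : n - 1 < n)
  have hstar := GrassmannGD.phiStar_eq_phi hp1 hV (by linarith)
  have hc0 : 0 < GrassmannGD.cQ := by rw [GrassmannGD.cQ]; positivity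
  -- `π² ≥ 8` is what makes the starting radius force `sinSq ≤ 2 c_Q ≤ 1/2`.
  have hc1 : GrassmannGD.cQ ≤ 1 / 4 := by
    rw [GrassmannGD.cQ, div_le_div_iff₀ (by positivity) (by norm_num)]
    nlinarith [Real.pi_gt_three]
  rw [hstar]
  set c := GrassmannGD.cQ
  have h0 : GrassmannGD.phi A (X 0) - GrassmannGD.phi A V ≤ c * δ := by
    have h1 := GrassmannGD.phi_sub_phi_le hV hX₀ hb ha
    have h2 := GrassmannGD.sinSq_le_grassmannDist_sq (X 0) V
    have h3 : GrassmannGD.grassmannDist (X 0) V ^ 2 ≤ _ :=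
      pow_le_pow_left₀ (Real.sqrt_nonneg _) hdist 2
    rw [Real.sq_sqrt (by positivity)] at h3
    have h4 := mul_le_mul_of_nonneg_left (h2.trans h3) hLpos.le
    rw [mul_div_cancel₀ _ hLpos.ne'] at h4
    rw [← hL] at h1
    linarith
  set q := 1 - c * (2 * δ / (5 * L)) with hq
  have hr0 : 0 ≤ 2 * δ / (5 * L) := by positivity
  have hr1 : 2 * δ / (5 * L) ≤ 1 := by
    rw [div_le_one (by positivity)]
    linarith
  have hq0 : 0 ≤ q := by nlinarith
  have hq1 : q ≤ 1 := by nlinarith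
  -- The induction also carries `e ≤ c δ`, which keeps each iterate where gradient dominance
  -- applies.
  have key : ∀ k ≤ N, X k ∈ GrassmannGD.stiefel n p ∧
      GrassmannGD.phi A (X k) - GrassmannGD.phi A V ≤ c * δ ∧
      GrassmannGD.phi A (X k) - GrassmannGD.phi A V ≤
        q ^ k * (GrassmannGD.phi A (X 0) - GrassmannGD.phi A V) := by
    intro k
    induction k with
    | zero => exact fun _ => ⟨hX₀, h0, by simp⟩
    | succ k ih =>
      intro hk
      obtain ⟨hXk, hck, hqk⟩ := ih (by omega)
      obtain ⟨hX', hphi⟩ := (hstep k (by omega)).mem_stiefel_and_phi_le hA hXk (hL ▸ hLpos) hb ha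
      rw [← hL] at hphi
      have hs := GrassmannGD.gap_mul_sinSq_le hp1 hV hXk
      have hs0 := GrassmannGD.sinSq_nonneg hV.1 hXk
      rw [← hδ] at hs
      have hs1 : GrassmannGD.sinSq (X k) V ≤ 1 / 2 := by
        refine le_of_mul_le_mul_left ?_ hgap
        nlinarith
      have hG := GrassmannGD.gradient_dominance hp1 hV hXk (hδ ▸ hgap) hs1
      rw [← hδ] at hG
      set e := GrassmannGD.phi A (X k) - GrassmannGD.phi A V with he
      have he0 : 0 ≤ e := by nlinarith
      have hG' := mul_le_mul_of_nonneg_left hG (show 0 ≤ 2 / (5 * L) by positivity)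
      have heq : 2 / (5 * L) * (δ * e) = 2 * δ / (5 * L) * e := by ring
      have hcon : GrassmannGD.phi A (X (k + 1)) - GrassmannGD.phi A V ≤ q * e := by
        -- The decrease obtained is larger by a factor `1 / c` than the one claimed.
        have : c * (2 * δ / (5 * L) * e) ≤ 1 * (2 * δ / (5 * L) * e) :=
          mul_le_mul_of_nonneg_right (by linarith) (mul_nonneg hr0 he0)
        have hqe : q * e = e - c * (2 * δ / (5 * L) * e) := by rw [hq]; ring
        rw [hqe]
        linarith
      refine ⟨hX', ?_, ?_⟩
      · have := mul_le_mul_of_nonneg_right hq1 he0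
        linarith
      · have := mul_le_mul_of_nonneg_left hqk hq0
        rw [pow_succ', mul_assoc]
        linarith
  exact fun k hk => (key k hk).2.2
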